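/- Let $e_1, e_2, e_3 \in \mathbb{Z}[t]$, put $\Delta(t) = (e_1-e_2)(e_1-e_3)(e_2-e_3)$, and let $\tau \in \mathbb{Q}$ be such that $\Delta(\tau) \neq 0$. Let $E$ be the elliptic curve $y^2 = (x-e_1)(x-e_2)(x-e_3)$ over $\mathbb{Q}(t)$, and let $E_\tau$ be the elliptic curve $y^2 = (x-e_1(\tau))(x-e_2(\tau))(x-e_3(\tau))$ over $\mathbb{Q}$. Let $\rho_\tau \colon E(\mathbb{Q}(t)) \to E_\tau(\mathbb{Q})$ be the specialization homomorphism: a point $(x,y)$ with $x, y$ regular at $t=\tau$ is sent to $(x(\tau), y(\tau))$, and all other points are sent to the point at infinity. Let $H$ be the subgroup of $\bigl(\mathbb{Q}(t)^\times/\mathbb{Q}(t)^{\times 2}\bigr)^3$ of triples whose entries have trivial product, and let $\delta \colon E(\mathbb{Q}(t)) \to H$ be the $2$-descent map: $\delta(O) = 1$, and the $i$-th entry of $\delta(x,y)$ is the class of $x - e_i$ if $x \neq e_i$ and the class of $\prod_{j \neq i}(e_i - e_j)$ if $x = e_i$. Let $H' \subset H$ be a finitely generated subgroup that contains $\delta\bigl(E(\mathbb{Q}(t))\bigr)$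 and all of whose elements can be specialized at $\tau$, i.e., have entries represented by rational functions that are regular and nonzero at $\tau$. Let $h_\tau \colon H' \to (\mathbb{Q}^\times/\mathbb{Q}^{\times 2})^3$ be the specialization homomorphism, which sends, in each entry, the class of such a function $f$ to the class of $f(\tau)$. If $h_\tau$ is injective, then $\rho_\tau \colon E(\mathbb{Q}(t)) \to E_\tau(\mathbb{Q})$ is injective. -/

import Mathlib

open Polynomial

noncomputable section

namespace EllSpec

/-! ### Square classes and the descent group -/

/-- The group `Kˣ / Kˣ²` of square classes of a field. -/
def SqClass (K : Type*) [Field K] : Type _ :=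
  Kˣ ⧸ (powMonoidHom 2 : Kˣ →* Kˣ).range

instance (K : Type*) [Field K] : CommGroup (SqClass K) :=
  inferInstanceAs (CommGroup (Kˣ ⧸ (powMonoidHom 2 : Kˣ →* Kˣ).range))

/-- The quotient map `Kˣ → Kˣ / Kˣ²`. -/
def sqMk (K : Type*) [Field K] : Kˣ →* SqClass K :=
  QuotientGroup.mk' (powMonoidHom 2 : Kˣ →* Kˣ).range

open scoped Classical in
/-- The square class of a nonzero element of `K`. (The value at `0` is arbitrary; it is never used
for the descent map of a curve whose three roots are distinct.) -/
def sqClass {K : Type*} [Field K] (x : K) : SqClass K :=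
  if hx : x ≠ 0 then sqMk K (Units.mk0 x hx) else 1

/-- The group `H` of triples of square classes whose product is trivial. -/
def descentGroup (K : Type*) [Field K] : Subgroup (Fin 3 → SqClass K) where
  carrier := {c | c 0 * c 1 * c 2 = 1}
  one_mem' := by simp
  mul_mem' {a b} ha hb := by
    change (a 0 * b 0) * (a 1 * b 1) * (a 2 * b 2) = 1
    rw [mul_mul_mul_comm (a 0), mul_mul_mul_comm (a 0 * a 1), ha, hb, one_mul]
  inv_mem' {a} ha := by
    change (a 0)⁻¹ * (a 1)⁻¹ * (a 2)⁻¹ = 1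
    rw [← mul_inv, ← mul_inv, ha, inv_one]

/-! ### Curves with full rational two-torsion -/

/-- The Weierstrass curve `y² = (x - a₀)(x - a₁)(x - a₂)`. -/
def curve {R : Type*} [CommRing R] (a : Fin 3 → R) : WeierstrassCurve R where
  a₁ := 0
  a₂ := -(a 0 + a 1 + a 2)
  a₃ := 0
  a₄ := a 0 * a 1 + a 0 * a 2 + a 1 * a 2
  a₆ := -(a 0 * a 1 * a 2)

/-- The group of points (with the point at infinity) of `y² = (x - a₀)(x - a₁)(x - a₂)`. -/
abbrev Pt {K : Type*} [Field K] (a : Fin 3 → K) : Type _ :=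
  WeierstrassCurve.Affine.Point (curve a)

lemma curve_equation_iff {R : Type*} [CommRing R] (a : Fin 3 → R) (x y : R) :
    WeierstrassCurve.Affine.Equation (curve a) x y ↔
      y ^ 2 = (x - a 0) * (x - a 1) * (x - a 2) := by
  rw [WeierstrassCurve.Affine.equation_iff]
  simp only [curve]
  constructor <;> intro h <;> linear_combination h

/-- The product `(a₀ - a₁)(a₀ - a₂)(a₁ - a₂)` of the root differences. -/
def rootDisc {R : Type*} [CommRing R] (a : Fin 3 → R) : R :=
  (a 0 - a 1) * (a 0 - a 2) * (a 1 - a 2)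

lemma curve_Δ {R : Type*} [CommRing R] (a : Fin 3 → R) :
    (curve a).Δ = 16 * rootDisc a ^ 2 := by
  simp only [curve, rootDisc, WeierstrassCurve.Δ, WeierstrassCurve.b₂, WeierstrassCurve.b₄,
    WeierstrassCurve.b₆, WeierstrassCurve.b₈]
  ring

open scoped Classical in
/-- The (complete) two-descent map. The point at infinity goes to the trivial class; the `i`-th
component of an affine point `(x, y)` is the class of `x - aᵢ`, replaced by
`∏ j ≠ i, (aᵢ - aⱼ)` when `x = aᵢ`. -/
def descentMap {K : Type*} [Field K] (a : Fin 3 → K) : Pt a → (Fin 3 → SqClass K)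
  | .zero => 1
  | .some x _ _ => fun i =>
      if x = a i then sqClass (∏ j ∈ Finset.univ.erase i, (a i - a j)) else sqClass (x - a i)

/-! ### Rational functions that are regular at a point -/

/-- The local ring of rational functions in `ℚ(t)` that are regular at `t = τ`. -/
def regularAt (τ : ℚ) : Subring (RatFunc ℚ) where
  carrier := {f | f.denom.eval τ ≠ 0}
  one_mem' := by simp
  zero_mem' := by simp
  mul_mem' := by
    intro f g hf hg h
    have h2 := Polynomial.eval_dvd (x := τ) (RatFunc.denom_mul_dvd f g)
    rw [h, zero_dvd_iff, Polynomial.eval_mul] at h2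
    exact mul_ne_zero hf hg h2
  add_mem' := by
    intro f g hf hg h
    have h2 := Polynomial.eval_dvd (x := τ) (RatFunc.denom_add_dvd f g)
    rw [h, zero_dvd_iff, Polynomial.eval_mul] at h2
    exact mul_ne_zero hf hg h2
  neg_mem' := by
    intro f hf h
    have h1 := congrArg (Polynomial.eval τ) (RatFunc.num_denom_neg f)
    have hc := RatFunc.isCoprime_num_denom (-f)
    obtain ⟨a, b, hab⟩ := hc
    have h3 := congrArg (Polynomial.eval τ) hab
    simp only [Polynomial.eval_mul, Polynomial.eval_add, Polynomial.eval_neg, h, mul_zero,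
      add_zero, Polynomial.eval_one] at h1 h3
    rcases mul_eq_zero.mp h1 with h4 | h4
    · rw [h4, mul_zero] at h3
      exact zero_ne_one h3
    · exact hf h4

/-- Evaluation at `t = τ` on the local ring of rational functions regular at `τ`. -/
def evalAt (τ : ℚ) : regularAt τ →+* ℚ where
  toFun f := RatFunc.eval (RingHom.id ℚ) τ (f : RatFunc ℚ)
  map_one' := by simp
  map_zero' := by simp
  map_mul' f g := RatFunc.eval_mul (RingHom.id ℚ) τ f.2 g.2
  map_add' f g := RatFunc.eval_add (RingHom.id ℚ) τ f.2 g.2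

lemma mem_regularAt_of_mul_self {τ : ℚ} {f : RatFunc ℚ} (h : f * f ∈ regularAt τ) :
    f ∈ regularAt τ := by
  intro hf
  have h1 := congrArg (Polynomial.eval τ) (RatFunc.num_denom_mul f f)
  obtain ⟨a, b, hab⟩ := RatFunc.isCoprime_num_denom f
  have h3 := congrArg (Polynomial.eval τ) hab
  simp only [Polynomial.eval_mul, Polynomial.eval_add, hf, mul_zero,
    add_zero, Polynomial.eval_one] at h1 h3
  rcases mul_eq_zero.mp h1.symm with h4 | h4
  · rw [mul_self_eq_zero.mp h4, mul_zero] at h3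
    exact zero_ne_one h3
  · exact h h4

/-! ### Specialization of square classes -/

/-- The map sending a rational function that is regular and nonvanishing at `τ` to its class in
`ℚ(t)ˣ / ℚ(t)ˣ²`. -/
def unitClass (τ : ℚ) : (regularAt τ)ˣ →* SqClass (RatFunc ℚ) :=
  (sqMk (RatFunc ℚ)).comp (Units.map ((regularAt τ).subtype : regularAt τ →* RatFunc ℚ))

/-- The map sending a rational function `f` that is regular and nonvanishing at `τ` to the class of
`f(τ)` in `ℚˣ / ℚˣ²`. -/
def unitValueClass (τ : ℚ) : (regularAt τ)ˣ →* SqClass ℚ :=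
  (sqMk ℚ).comp (Units.map (evalAt τ : regularAt τ →* ℚ))

lemma unitClass_ker_le (τ : ℚ) : (unitClass τ).ker ≤ (unitValueClass τ).ker := by
  intro u hu
  rw [MonoidHom.mem_ker] at hu ⊢
  have hu' := (QuotientGroup.eq_one_iff _).mp hu
  obtain ⟨v, hv⟩ := hu'
  have hv1 : (v : RatFunc ℚ) * v = ((u : regularAt τ) : RatFunc ℚ) := by
    have := congrArg (Units.val) hv
    simpa [sq] using this
  have hv2 : ((v⁻¹ : (RatFunc ℚ)ˣ) : RatFunc ℚ) * ((v⁻¹ : (RatFunc ℚ)ˣ) : RatFunc ℚ)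
      = (((u⁻¹ : (regularAt τ)ˣ) : regularAt τ) : RatFunc ℚ) := by
    have := congrArg (fun w : (RatFunc ℚ)ˣ => ((w⁻¹ : (RatFunc ℚ)ˣ) : RatFunc ℚ)) hv
    simp only [powMonoidHom_apply, sq, mul_inv, Units.val_mul] at this
    rw [this, ← map_inv]
    rfl
  have m1 : (v : RatFunc ℚ) ∈ regularAt τ :=
    mem_regularAt_of_mul_self (by rw [hv1]; exact (u : regularAt τ).2)
  have m2 : ((v⁻¹ : (RatFunc ℚ)ˣ) : RatFunc ℚ) ∈ regularAt τ :=
    mem_regularAt_of_mul_self (by rw [hv2]; exact ((u⁻¹ : (regularAt τ)ˣ) : regularAt τ).2)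
  let w : (regularAt τ)ˣ :=
    ⟨⟨v, m1⟩, ⟨_, m2⟩, Subtype.ext (by simp), Subtype.ext (by simp)⟩
  have hw : w * w = u := Units.ext (Subtype.ext hv1)
  refine (QuotientGroup.eq_one_iff _).mpr ⟨Units.map (evalAt τ : regularAt τ →* ℚ) w, ?_⟩
  rw [powMonoidHom_apply, sq, ← map_mul, hw]

/-- The square classes in `ℚ(t)ˣ / ℚ(t)ˣ²` that can be specialized at `τ`: those represented by a
rational function that is regular and nonvanishing at `τ`. -/
def specClasses (τ : ℚ) : Subgroup (SqClass (RatFunc ℚ)) :=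
  (unitClass τ).range

/-- Specialization at `τ` of square classes: the class of `f` goes to the class of `f(τ)`, for `f`
regular and nonvanishing at `τ`. -/
def specClass (τ : ℚ) : specClasses τ →* SqClass ℚ :=
  (QuotientGroup.lift (unitClass τ).ker (unitValueClass τ) (unitClass_ker_le τ)).comp
    (QuotientGroup.quotientKerEquivRange (unitClass τ)).symm.toMonoidHom

/-- The defining property of `specClass`. -/
lemma specClass_unitClass (τ : ℚ) (u : (regularAt τ)ˣ) :
    specClass τ ⟨unitClass τ u, u, rfl⟩ = unitValueClass τ u := by
  have h : (QuotientGroup.quotientKerEquivRange (unitClass τ)).symm ⟨unitClass τ u, u, rfl⟩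
      = (QuotientGroup.mk u : (regularAt τ)ˣ ⧸ (unitClass τ).ker) := by
    rw [MulEquiv.symm_apply_eq]
    rfl
  change QuotientGroup.lift (unitClass τ).ker (unitValueClass τ) (unitClass_ker_le τ)
    ((QuotientGroup.quotientKerEquivRange (unitClass τ)).symm ⟨unitClass τ u, u, rfl⟩) = _
  rw [h]
  rfl

/-- The triples of square classes all of whose entries can be specialized at `τ`. -/
def specTriples (τ : ℚ) : Subgroup (Fin 3 → SqClass (RatFunc ℚ)) :=
  Subgroup.pi Set.univ fun _ => specClasses τ

/-- Componentwise specialization at `τ` of triples of square classes. -/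
def specTriple (τ : ℚ) : specTriples τ →* (Fin 3 → SqClass ℚ) where
  toFun c i := specClass τ ⟨c.1 i, c.2 i (Set.mem_univ i)⟩
  map_one' := funext fun _ => map_one (specClass τ)
  map_mul' c d := funext fun i =>
    map_mul (specClass τ) ⟨c.1 i, c.2 i (Set.mem_univ i)⟩ ⟨d.1 i, d.2 i (Set.mem_univ i)⟩

/-- The specialization homomorphism `h_τ : H' → (ℚˣ / ℚˣ²)³` on a group `H'` of triples of square
classes that can be specialized at `τ`. -/
def specOn (τ : ℚ) (H' : Subgroup (Fin 3 → SqClass (RatFunc ℚ))) (h : H' ≤ specTriples τ) :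
    H' →* (Fin 3 → SqClass ℚ) :=
  (specTriple τ).comp (Subgroup.inclusion h)

/-! ### Specialization of points -/

/-- The roots `eᵢ ∈ ℤ[t]`, viewed in `ℚ(t)`. -/
def genRoots (e : Fin 3 → ℤ[X]) : Fin 3 → RatFunc ℚ :=
  fun i => algebraMap ℚ[X] (RatFunc ℚ) ((e i).map (Int.castRingHom ℚ))

/-- The specialized roots `eᵢ(τ) ∈ ℚ`. -/
def specRoots (e : Fin 3 → ℤ[X]) (τ : ℚ) : Fin 3 → ℚ :=
  fun i => aeval τ (e i)

lemma genRoots_mem (e : Fin 3 → ℤ[X]) (τ : ℚ) (i : Fin 3) : genRoots e i ∈ regularAt τ := by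
  change Polynomial.eval τ (RatFunc.denom _) ≠ 0
  simp [genRoots]

lemma evalAt_genRoots (e : Fin 3 → ℤ[X]) (τ : ℚ) (i : Fin 3) :
    evalAt τ ⟨genRoots e i, genRoots_mem e τ i⟩ = specRoots e τ i := by
  change RatFunc.eval (RingHom.id ℚ) τ (algebraMap ℚ[X] (RatFunc ℚ) _) = _
  rw [RatFunc.eval_algebraMap]
  simp [specRoots, aeval_def, eval₂_eq_eval_map]

lemma rootDisc_specRoots (e : Fin 3 → ℤ[X]) (τ : ℚ) :
    rootDisc (specRoots e τ) = aeval τ (rootDisc e) := by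
  simp [rootDisc, specRoots]

lemma spec_nonsingular (e : Fin 3 → ℤ[X]) (τ : ℚ) (hτ : aeval τ (rootDisc e) ≠ 0)
    (x y : regularAt τ)
    (h : WeierstrassCurve.Affine.Nonsingular (curve (genRoots e)) (x : RatFunc ℚ) y) :
    WeierstrassCurve.Affine.Nonsingular (curve (specRoots e τ)) (evalAt τ x) (evalAt τ y) := by
  have hΔ : (curve (specRoots e τ)).Δ ≠ 0 := by
    rw [curve_Δ, rootDisc_specRoots]
    exact mul_ne_zero (by norm_num) (pow_ne_zero 2 hτ)
  rw [← WeierstrassCurve.Affine.equation_iff_nonsingular_of_Δ_ne_zero hΔ, curve_equation_iff]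
  have h1 := (curve_equation_iff _ _ _).mp h.1
  have h2 : y ^ 2 = (x - ⟨genRoots e 0, genRoots_mem e τ 0⟩)
      * (x - ⟨genRoots e 1, genRoots_mem e τ 1⟩) * (x - ⟨genRoots e 2, genRoots_mem e τ 2⟩) :=
    Subtype.ext (by simpa using h1)
  have h3 := congrArg (evalAt τ) h2
  simpa only [map_pow, map_mul, map_sub, evalAt_genRoots] using h3

open scoped Classical in
/-- The specialization map `ρ_τ : E(ℚ(t)) → E_τ(ℚ)` for `Δ(τ) ≠ 0`: an affine point with coordinates
regular at `τ` goes to the point with the specialized coordinates; every other point (the point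
at infinity, or a point whose coordinates have a pole at `τ`) goes to the point at infinity. -/
def specPt (e : Fin 3 → ℤ[X]) (τ : ℚ) (hτ : aeval τ (rootDisc e) ≠ 0) :
    Pt (genRoots e) → Pt (specRoots e τ)
  | .zero => .zero
  | .some x y h =>
      if hxy : x ∈ regularAt τ ∧ y ∈ regularAt τ then
        .some (evalAt τ ⟨x, hxy.1⟩) (evalAt τ ⟨y, hxy.2⟩)
          (spec_nonsingular e τ hτ ⟨x, hxy.1⟩ ⟨y, hxy.2⟩ h)
      else .zero

end EllSpec

end

namespace EllSpec

/-! ### Heights on `ℤ[t]` and the duplication map -/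

/-! Two facts suffice: no affine point of E(ℚ(t)) has a pole at τ (`mem_regularAt_of_equation`), and
two distinct affine points with the same specialization would differ by a point with a pole
(`exists_pole_of_value_eq`, where Δ(τ) ≠ 0 enters).

For the first, suppose P = (x, y) has a pole at τ. Each (x - eᵢ)/x has value 1 at τ, and so does
x³/y², so up to squares every x - eᵢ has value 1. Thus h_τ kills δ(P), and injectivity makes every x
- eᵢ a square (`exists_sq_eq_sub_of_pole`). Hence P can be halved, and a suitable choice of signs
gives the half a pole again (`exists_half`). Iterating gives an infinite chain of halves. Each step
multiplies X = x - e₀ by a function of value 4 at τ, so the X's are pairwise distinct.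

A height argument excludes such a chain (`finite_range_of_dup`). Write X = a/b in lowest terms over
ℤ[t] and measure (a, b) by its sup norm on a circle |z| = r. Duplication is given by two quartic
forms with no common zero over the circle, and cancellation between their values is confined to
divisors of a fixed polynomial. So doubling essentially raises the norm to the fourth power, the
halves stay bounded, and only finitely many integer polynomials satisfy a given bound. -/

/-- Only finitely many integer polynomials are bounded by `M` on a circle of radius at least `2`. -/
theorem finite_setOf_forall_norm_aeval_le {r : ℝ} (hr : 2 ≤ r) (M : ℝ) :
    {P : ℤ[X] | ∀ z : ℂ, ‖z‖ = r → ‖aeval z P‖ ≤ M}.Finite := by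
  have hr0 : 0 < r := by linarith
  have hcoeff : ∀ P ∈ {P : ℤ[X] | ∀ z : ℂ, ‖z‖ = r → ‖aeval z P‖ ≤ M}, ∀ k,
      |(P.coeff k : ℝ)| * r ^ k ≤ M := by
    intro P hP k
    have hd : ∀ k, iteratedDeriv k (fun z : ℂ => aeval z P) =
        fun z => aeval z (derivative^[k] P) := by
      intro k
      induction k with
      | zero => simp
      | succ k ih =>
        rw [iteratedDeriv_succ, ih, Function.iterate_succ_apply']
        funext z
        exact Polynomial.deriv_aeval _
    -- Cauchy's estimate at 0 bounds the k-th coefficient by M / r ^ k.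
    have h := Complex.norm_iteratedDeriv_le_of_forall_mem_sphere_norm_le (c := 0) (R := r) (C := M)
      (f := fun z : ℂ => aeval z P) k hr0
      (Polynomial.differentiable_aeval P).diffContOnCl
      (fun z hz => hP z (by simpa using hz))
    rw [hd] at h
    have h2 : aeval (0 : ℂ) (derivative^[k] P) = (k.factorial : ℂ) * (P.coeff k : ℂ) := by
      rw [← Polynomial.coeff_zero_eq_aeval_zero', Polynomial.coeff_iterate_derivative]
      simp [Nat.descFactorial_self]
    simp only [h2, norm_mul, Complex.norm_natCast, Complex.norm_intCast] at h
    rw [mul_div_assoc] at h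
    have := le_of_mul_le_mul_left h (by positivity)
    rwa [le_div_iff₀ (by positivity)] at this
  set N := ⌈M⌉₊
  have hM : M ≤ N := Nat.le_ceil M
  refine Set.Finite.subset (Set.Finite.image
    (fun c : Fin (N + 1) → ℤ => ∑ k : Fin (N + 1), monomial (k : ℕ) (c k))
    (Set.Finite.pi (fun _ : Fin (N + 1) => Set.finite_Icc (-(N : ℤ)) N))) ?_
  intro P hP
  -- A nonzero integer coefficient would give 2 ^ k ≤ r ^ k ≤ M ≤ N < k; this is where r ≥ 2 is
  -- needed.
  have hz : ∀ k, N < k → P.coeff k = 0 := by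
    intro k hk
    by_contra h0
    have h1 : (1 : ℝ) ≤ |(P.coeff k : ℝ)| := by exact_mod_cast Int.one_le_abs h0
    have h2 := hcoeff P hP k
    have h3 : (2 : ℝ) ^ k ≤ r ^ k := pow_le_pow_left₀ (by norm_num) hr k
    have h4 : (k : ℝ) < 2 ^ k := by exact_mod_cast Nat.lt_two_pow_self
    have h5 : (N : ℝ) < k := by exact_mod_cast hk
    nlinarith
  refine ⟨fun k => P.coeff k, ?_, ?_⟩
  · intro k _
    have h1 := hcoeff P hP k
    have h3 : (1 : ℝ) ≤ r ^ (k : ℕ) := one_le_pow₀ (by linarith)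
    have h4 : |(P.coeff k : ℝ)| ≤ N := by nlinarith [abs_nonneg (P.coeff k : ℝ)]
    have h5 : |P.coeff k| ≤ N := by exact_mod_cast h4
    exact abs_le.mp h5
  · have : P.natDegree < N + 1 := by
      rw [Nat.lt_succ_iff, Polynomial.natDegree_le_iff_coeff_eq_zero]
      exact hz
    conv_rhs => rw [P.as_sum_range' _ this]
    simp [Fin.sum_univ_eq_sum_range (fun k => monomial k (P.coeff k))]

theorem finite_setOf_dvd_intPolynomial {R : ℤ[X]} (hR : R ≠ 0) : {g : ℤ[X] | g ∣ R}.Finite := by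
  have : Finite ℤ[X]ˣ := by
    refine Finite.of_surjective (fun u : ℤˣ => Units.map (C : ℤ →+* ℤ[X]).toMonoidHom u) ?_
    intro v
    obtain ⟨r, hr, h⟩ := Polynomial.isUnit_iff.mp v.isUnit
    exact ⟨hr.unit, Units.ext h⟩
  have := Fintype.ofFinite ℤ[X]ˣ
  have : Fintype {g // g ∣ R} := UniqueFactorizationMonoid.fintypeSubtypeDvd R hR
  exact Set.finite_coe_iff.mp (Finite.of_fintype {g // g ∣ R})

theorem exists_norm_aeval_le_of_sphere (r : ℝ) (P : ℤ[X]) :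
    ∃ C : ℝ, ∀ z : ℂ, ‖z‖ = r → ‖aeval z P‖ ≤ C := by
  obtain ⟨C, hC⟩ := (isCompact_sphere (0 : ℂ) r).exists_bound_of_continuousOn
    (f := fun z => aeval z P) (Polynomial.continuous_aeval P).continuousOn
  exact ⟨C, fun z hz => hC z (by simpa using hz)⟩

theorem exists_sphere_aeval_ne_zero {R : ℤ[X]} (hR : R ≠ 0) :
    ∃ r : ℝ, 2 ≤ r ∧ ∀ z : ℂ, ‖z‖ = r → aeval z R ≠ 0 := by
  have hfin : ((R.rootSet ℂ : Set ℂ).image norm).Finite := (R.rootSet_finite ℂ).image _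
  obtain ⟨b, hb⟩ := hfin.bddAbove
  refine ⟨max 2 (b + 1), le_max_left _ _, fun z hz h => ?_⟩
  have h1 := hb ⟨z, by rw [mem_rootSet]; exact ⟨hR, h⟩, rfl⟩
  have := le_max_right 2 (b + 1)
  linarith

/-- Numerator of the duplication map of `Y² = X (X - p) (X - q)` at `X = a / b`. -/
def dupNum {R : Type*} [CommRing R] (p q a b : R) : R := (a ^ 2 - p * q * b ^ 2) ^ 2

/-- Denominator of the duplication map of `Y² = X (X - p) (X - q)` at `X = a / b`. -/
def dupDen {R : Type*} [CommRing R] (p q a b : R) : R := 4 * a * b * (a - p * b) * (a - q * b)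

/-- A multiple of the resultant of the two duplication forms. -/
def dupRes {R : Type*} [CommRing R] (p q : R) : R := 16 * (p * q) ^ 2 * (p - q) ^ 4

theorem dvd_dupRes_mul_pow_right {R : Type*} [CommRing R] {p q a b g : R}
    (h1 : g ∣ dupNum p q a b) (h2 : g ∣ dupDen p q a b) : g ∣ dupRes p q * b ^ 9 := by
  -- With X = a/b, σ = p + q, T = 2X + σ, S = 4(X - σ)T + 16pq and f = X(X - p)(X - q), Euclid's
  -- algorithm gives (X² - pq)S = 4fT + 4pq(p - q)². Squaring this and homogenizing yields the
  -- identity.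
  have key : dupRes p q * b ^ 9 =
      dupNum p q a b * (b * (4 * (a - (p + q) * b) * (2 * a + (p + q) * b) + 16 * (p * q) * b ^ 2) ^ 2)
      + dupDen p q a b * ((2 * a + (p + q) * b) * (8 * (p * q) * (4 * (p * q) - (p + q) ^ 2) * b ^ 4
        - 4 * a * (a - p * b) * (a - q * b) * (2 * a + (p + q) * b))) := by
    simp only [dupRes, dupNum, dupDen]; ring
  rw [key]
  exact dvd_add (h1.mul_right _) (h2.mul_right _)

/-- Translation by the 2-torsion point (0, 0) is X ↦ pq/X and leaves the duplication map unchanged;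
it exchanges the roles of a and b. -/
theorem dvd_dupRes_mul_pow_left {R : Type*} [CommRing R] {p q a b g : R}
    (h1 : g ∣ dupNum p q a b) (h2 : g ∣ dupDen p q a b) : g ∣ dupRes p q * a ^ 9 := by
  refine dvd_dupRes_mul_pow_right (a := p * q * b) (b := a) ?_ ?_
  · have : dupNum p q (p * q * b) a = dupNum p q a b * (p * q) ^ 2 := by
      simp only [dupNum]; ring
    rw [this]; exact h1.mul_right _
  · have : dupDen p q (p * q * b) a = dupDen p q a b * (p * q) ^ 2 := by
      simp only [dupDen]; ring
    rw [this]; exact h2.mul_right _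

/-- The forms have no common nontrivial zero over the circle, so compactness gives a positive
minimum on unit vectors; homogeneity of degree 4 does the rest. -/
theorem exists_mul_norm_pow_le_norm_dup {p q : ℤ[X]} {r : ℝ}
    (hr : ∀ z : ℂ, ‖z‖ = r → aeval z (dupRes p q) ≠ 0) :
    ∃ c : ℝ, 0 < c ∧ ∀ z a b : ℂ, ‖z‖ = r → c * ‖(a, b)‖ ^ 4 ≤
      ‖(dupNum (aeval z p) (aeval z q) a b, dupDen (aeval z p) (aeval z q) a b)‖ := by
  set f : ℂ × ℂ × ℂ → ℝ := fun w =>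
    ‖(dupNum (aeval w.1 p) (aeval w.1 q) w.2.1 w.2.2,
      dupDen (aeval w.1 p) (aeval w.1 q) w.2.1 w.2.2)‖ with hf
  have hcont : Continuous f := by
    have hc : ∀ P : ℤ[X], Continuous fun w : ℂ × ℂ × ℂ => aeval w.1 P := fun P =>
      (Polynomial.continuous_aeval P).comp continuous_fst
    have := hc p
    have := hc q
    simp only [hf, dupNum, dupDen]
    fun_prop
  have hpos : ∀ w ∈ Metric.sphere (0 : ℂ) r ×ˢ Metric.sphere (0 : ℂ × ℂ) 1, 0 < f w := by
    rintro ⟨z, a, b⟩ ⟨hz, hab⟩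
    have hz' := hr z (by simpa using hz)
    have hres : dupRes (aeval z p) (aeval z q) ≠ 0 := by
      simpa only [dupRes, map_mul, map_pow, map_sub, map_ofNat] using hz'
    refine norm_pos_iff.mpr fun h0 => ?_
    rw [Prod.mk_eq_zero] at h0
    -- Divisibility by g = 0 means vanishing, so the divisibility lemmas force a = b = 0.
    have hb := dvd_dupRes_mul_pow_right (zero_dvd_iff.mpr h0.1) (zero_dvd_iff.mpr h0.2)
    have ha := dvd_dupRes_mul_pow_left (zero_dvd_iff.mpr h0.1) (zero_dvd_iff.mpr h0.2)
    rw [zero_dvd_iff] at ha hb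
    have ha' : a = 0 := by simpa [hres] using ha
    have hb' : b = 0 := by simpa [hres] using hb
    simp [ha', hb'] at hab
  obtain ⟨c, hc0, hc⟩ : ∃ c : ℝ, 0 < c ∧
      ∀ w ∈ Metric.sphere (0 : ℂ) r ×ˢ Metric.sphere (0 : ℂ × ℂ) 1, c ≤ f w :=
    ((isCompact_sphere _ _).prod (isCompact_sphere _ _)).exists_forall_le' hcont.continuousOn hpos
  refine ⟨c, hc0, fun z a b hz => ?_⟩
  by_cases hab : (a, b) = 0
  · simp [hab]
  set n := ‖(a, b)‖ with hn
  have hn0 : 0 < n := norm_pos_iff.mpr hab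
  have hnC : (n : ℂ) ≠ 0 := by exact_mod_cast hn0.ne'
  have h1 := hc (z, a / n, b / n) ⟨by simpa using hz, by
    have : (a / (n : ℂ), b / (n : ℂ)) = (n : ℂ)⁻¹ • (a, b) := by
      simp [div_eq_inv_mul]
    simp only [mem_sphere_iff_norm, sub_zero]
    rw [this, norm_smul, ← hn]
    simp [abs_of_pos hn0, hn0.ne']⟩
  have h2 : (dupNum (aeval z p) (aeval z q) a b, dupDen (aeval z p) (aeval z q) a b) =
      (n : ℂ) ^ 4 • (dupNum (aeval z p) (aeval z q) (a / n) (b / n),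
        dupDen (aeval z p) (aeval z q) (a / n) (b / n)) := by
    simp only [dupNum, dupDen, Prod.smul_mk, smul_eq_mul, Prod.mk.injEq]
    constructor <;> field_simp
  rw [h2, norm_smul, norm_pow, Complex.norm_real, Real.norm_of_nonneg hn0.le, mul_comm]
  exact mul_le_mul_of_nonneg_left h1 (by positivity)

/-! ### Boundedness of heights under repeated halving -/

theorem _root_.IsRelPrime.dvd_of_dvd_mul_of_dvd_mul {R : Type*} [CommRing R] [IsDomain R]
    [UniqueFactorizationMonoid R] {a b c g : R} (hab : IsRelPrime a b) (ha : g ∣ c * a)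
    (hb : g ∣ c * b) : g ∣ c := by
  rcases eq_or_ne g 0 with rfl | hg
  · rw [zero_dvd_iff, mul_eq_zero] at ha hb
    rw [zero_dvd_iff]
    by_contra hc
    exact hab.ne_zero_or_ne_zero.elim (· (ha.resolve_left hc)) (· (hb.resolve_left hc))
  obtain ⟨r, s, ⟨c', rfl⟩, hs, rfl⟩ := exists_dvd_and_dvd_of_dvd_mul ha
  rw [mul_assoc] at hb
  exact mul_dvd_mul_left r ((hab.of_dvd_left hs).dvd_of_dvd_mul_right
    ((mul_dvd_mul_iff_left (left_ne_zero_of_mul hg)).mp hb))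

theorem exists_common_factor {R : Type*} [CommRing R] [IsDomain R] [UniqueFactorizationMonoid R] {a b F G : R}
    (hab : IsRelPrime a b) (ha : a ≠ 0) (h : F * b = G * a) : ∃ g, F = g * a ∧ G = g * b := by
  obtain ⟨g, hg⟩ : a ∣ F := hab.dvd_of_dvd_mul_right (h ▸ dvd_mul_left a G)
  refine ⟨g, by rw [hg, mul_comm], mul_right_cancel₀ ha ?_⟩
  rw [← h, hg]; ring

/-- Here x (n + 1) is the X-coordinate of a half of the point with X-coordinate x n. If (a, b)
represents x (n + 1), the duplication forms at (a, b) equal g times the reduced pair of x n, with g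
among the finitely many divisors of `dupRes p q`. One bound therefore propagates along the whole
sequence. -/
theorem finite_range_of_dup {K : Type*} [Field K] {ι : ℤ[X] →+* K} (hι : Function.Injective ι)
    (hfrac : ∀ x : K, ∃ a b : ℤ[X], b ≠ 0 ∧ IsRelPrime a b ∧ x = ι a / ι b) {p q : ℤ[X]}
    (hres : dupRes p q ≠ 0) {x : ℕ → K} (hx0 : ∀ n, x n ≠ 0)
    (hx : ∀ n, dupDen (ι p) (ι q) (x (n + 1)) 1 * x n = dupNum (ι p) (ι q) (x (n + 1)) 1) :
    (Set.range x).Finite := by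
  obtain ⟨r, hr2, hr⟩ := exists_sphere_aeval_ne_zero hres
  obtain ⟨c, hc0, hc⟩ := exists_mul_norm_pow_le_norm_dup hr
  obtain ⟨C, hC⟩ : ∃ C : ℝ, ∀ g ∈ {g : ℤ[X] | g ∣ dupRes p q}, ∀ z : ℂ, ‖z‖ = r →
      ‖aeval z g‖ ≤ C := by
    choose B hB using exists_norm_aeval_le_of_sphere r
    obtain ⟨C, hC⟩ := ((finite_setOf_dvd_intPolynomial hres).image B).bddAbove
    exact ⟨C, fun g hg z hz => (hB g z hz).trans (hC ⟨g, hg, rfl⟩)⟩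
  choose a b hb0 hab hxab using fun n => hfrac (x n)
  have ha0 : ∀ n, a n ≠ 0 := fun n h => hx0 n (by simp [hxab n, h])
  have hιb : ∀ n, ι (b n) ≠ 0 := fun n => (map_ne_zero_iff ι hι).mpr (hb0 n)
  obtain ⟨Ma, hMa⟩ := exists_norm_aeval_le_of_sphere r (a 0)
  obtain ⟨Mb, hMb⟩ := exists_norm_aeval_le_of_sphere r (b 0)
  -- M ≥ 1 and C ≤ cM close the induction: c N ^ 4 ≤ C M ≤ c M ^ 2 ≤ c M ^ 4 for the next norm N.
  set M := max (max Ma Mb) (max 1 (C / c))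
  have hM1 : 1 ≤ M := (le_max_left _ _).trans (le_max_right _ _)
  have hMC : C ≤ M * c := (div_le_iff₀ hc0).mp ((le_max_right _ _).trans (le_max_right _ _))
  have hbound : ∀ n (z : ℂ), ‖z‖ = r → ‖(aeval z (a n), aeval z (b n))‖ ≤ M := by
    intro n
    induction n with
    | zero =>
      intro z hz
      exact max_le ((hMa z hz).trans ((le_max_left _ _).trans (le_max_left _ _)))
        ((hMb z hz).trans ((le_max_right _ _).trans (le_max_left _ _)))
    | succ n ih =>
      intro z hz
      have hcross : dupNum p q (a (n + 1)) (b (n + 1)) * b n =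
          dupDen p q (a (n + 1)) (b (n + 1)) * a n := by
        apply hι
        have h := hx n
        have h1 := hιb n
        have h2 := hιb (n + 1)
        rw [hxab n, hxab (n + 1)] at h
        simp only [dupNum, dupDen] at h ⊢
        simp only [map_mul, map_sub, map_pow, map_ofNat]
        field_simp at h
        linear_combination -h
      obtain ⟨g, hgF, hgG⟩ := exists_common_factor (hab n) (ha0 n) hcross
      have hgF' := Dvd.intro _ hgF.symm
      have hgG' := Dvd.intro _ hgG.symm
      have hg : g ∣ dupRes p q :=
        (hab (n + 1)).pow.dvd_of_dvd_mul_of_dvd_mul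
          (dvd_dupRes_mul_pow_left hgF' hgG') (dvd_dupRes_mul_pow_right hgF' hgG')
      have h1 := hc z (aeval z (a (n + 1))) (aeval z (b (n + 1))) hz
      have h2 : (dupNum (aeval z p) (aeval z q) (aeval z (a (n + 1))) (aeval z (b (n + 1))),
          dupDen (aeval z p) (aeval z q) (aeval z (a (n + 1))) (aeval z (b (n + 1)))) =
          aeval z g • (aeval z (a n), aeval z (b n)) := by
        have e1 := congrArg (aeval z) hgF
        have e2 := congrArg (aeval z) hgG
        simp only [dupNum, dupDen, map_mul, map_sub, map_pow, map_ofNat] at e1 e2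
        simp only [dupNum, dupDen, Prod.smul_mk, smul_eq_mul, Prod.mk.injEq]
        exact ⟨e1, e2⟩
      rw [h2, norm_smul] at h1
      by_contra hlt
      rw [not_le] at hlt
      set N := ‖(aeval z (a (n + 1)), aeval z (b (n + 1)))‖
      have h3 : ‖aeval z g‖ * ‖(aeval z (a n), aeval z (b n))‖ ≤ C * M :=
        mul_le_mul (hC g hg z hz) (ih z hz) (norm_nonneg _)
          ((norm_nonneg _).trans (hC g hg z hz))
      have h4 : C * M ≤ c * M ^ 2 := by nlinarith
      have h5 : M ^ 4 < N ^ 4 := pow_lt_pow_left₀ hlt (by linarith) (by norm_num)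
      have h6 : M ^ 2 ≤ M ^ 4 := pow_le_pow_right₀ hM1 (by norm_num)
      nlinarith
  have hfin := finite_setOf_forall_norm_aeval_le hr2 M
  refine ((hfin.prod hfin).image fun w => ι w.1 / ι w.2).subset ?_
  rintro _ ⟨n, rfl⟩
  exact ⟨(a n, b n), ⟨fun z hz => (le_max_left _ _).trans (hbound n z hz),
    fun z hz => (le_max_right _ _).trans (hbound n z hz)⟩, (hxab n).symm⟩

/-! ### Values of rational functions at `τ` -/
theorem exists_intPolynomial_fraction (x : RatFunc ℚ) : ∃ a b : ℤ[X], b ≠ 0 ∧ IsRelPrime a b ∧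
    x = (algebraMap ℚ[X] (RatFunc ℚ)).comp (mapRingHom (Int.castRingHom ℚ)) a /
      (algebraMap ℚ[X] (RatFunc ℚ)).comp (mapRingHom (Int.castRingHom ℚ)) b := by
  have hmap : ∀ P : ℤ[X], P ≠ 0 → P.map (Int.castRingHom ℚ) ≠ 0 := fun P hP =>
    (Polynomial.map_ne_zero_iff Int.cast_injective).mpr hP
  have hclear : ∀ P : ℚ[X], ∃ (n : ℤ) (Q : ℤ[X]), n ≠ 0 ∧
      Q.map (Int.castRingHom ℚ) = C (n : ℚ) * P := by
    intro P
    obtain ⟨b, hb0, hb⟩ := IsLocalization.integerNormalization_spec (nonZeroDivisors ℤ) P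
    exact ⟨b, _, nonZeroDivisors.ne_zero hb0, by simpa [smul_eq_C_mul] using hb⟩
  obtain ⟨m, A, hm, hA⟩ := hclear x.num
  obtain ⟨n, B, hn, hB⟩ := hclear x.denom
  have hd := x.denom_ne_zero
  have hB0 : B ≠ 0 := by
    rintro rfl
    simp [hn, hd] at hB
  have hmB0 : C m * B ≠ 0 := mul_ne_zero (C_ne_zero.mpr hm) hB0
  obtain ⟨a, b, c, hab, hac, hbc⟩ :=
    UniqueFactorizationMonoid.exists_reduced_factors' (C n * A) (C m * B) hmB0
  have hc0 : c ≠ 0 := by rintro rfl; exact hmB0 (by rw [← hbc, zero_mul])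
  have hb0 : b ≠ 0 := by rintro rfl; exact hmB0 (by rw [← hbc, mul_zero])
  refine ⟨a, b, hb0, hab, ?_⟩
  have hne : ∀ P : ℤ[X], P ≠ 0 → algebraMap ℚ[X] (RatFunc ℚ) (P.map (Int.castRingHom ℚ)) ≠ 0 := by
    exact fun P hP => RatFunc.algebraMap_ne_zero (hmap P hP)
  have hcross : a.map (Int.castRingHom ℚ) * x.denom = b.map (Int.castRingHom ℚ) * x.num := by
    have h1 := congrArg (Polynomial.map (Int.castRingHom ℚ)) hac
    have h2 := congrArg (Polynomial.map (Int.castRingHom ℚ)) hbc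
    simp only [Polynomial.map_mul, hA, hB, eq_intCast, Polynomial.map_intCast, ← C_eq_intCast (R := ℚ)] at h1 h2
    have h3 : c.map (Int.castRingHom ℚ) * (C (m : ℚ) * C (n : ℚ)) ≠ 0 := by
      refine mul_ne_zero (hmap c hc0) ?_
      simp [hm, hn]
    refine mul_left_cancel₀ h3 ?_
    linear_combination C (m : ℚ) * C (n : ℚ) * x.denom * h1 - C (m : ℚ) * C (n : ℚ) * x.num * h2
  have hcross' := congrArg (algebraMap ℚ[X] (RatFunc ℚ)) hcross
  rw [map_mul, map_mul] at hcross'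
  have hd' : algebraMap ℚ[X] (RatFunc ℚ) x.denom ≠ 0 := RatFunc.algebraMap_ne_zero hd
  have := hne b hb0
  conv_lhs => rw [← RatFunc.num_div_denom x]
  simp only [RingHom.comp_apply, coe_mapRingHom]
  rw [div_eq_div_iff hd' this]
  linear_combination -hcross'

/-- `f` is regular at `τ` with value `c`. -/
def HasValueAt (τ : ℚ) (f : RatFunc ℚ) (c : ℚ) : Prop :=
  ∃ u : regularAt τ, (u : RatFunc ℚ) = f ∧ evalAt τ u = c

namespace HasValueAt
variable {τ : ℚ} {f g : RatFunc ℚ} {c d : ℚ}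

theorem mem (h : HasValueAt τ f c) : f ∈ regularAt τ := by
  obtain ⟨u, rfl, -⟩ := h
  exact u.2

theorem unique (h : HasValueAt τ f c) (h' : HasValueAt τ f d) : c = d := by
  obtain ⟨u, rfl, rfl⟩ := h
  obtain ⟨v, huv, rfl⟩ := h'
  rw [Subtype.ext huv]

theorem one (τ : ℚ) : HasValueAt τ 1 1 := ⟨1, rfl, map_one _⟩

theorem add (h : HasValueAt τ f c) (h' : HasValueAt τ g d) : HasValueAt τ (f + g) (c + d) := by
  obtain ⟨u, rfl, rfl⟩ := h
  obtain ⟨v, rfl, rfl⟩ := h'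
  exact ⟨u + v, rfl, map_add _ _ _⟩

theorem sub (h : HasValueAt τ f c) (h' : HasValueAt τ g d) : HasValueAt τ (f - g) (c - d) := by
  obtain ⟨u, rfl, rfl⟩ := h
  obtain ⟨v, rfl, rfl⟩ := h'
  exact ⟨u - v, rfl, map_sub _ _ _⟩

theorem mul (h : HasValueAt τ f c) (h' : HasValueAt τ g d) : HasValueAt τ (f * g) (c * d) := by
  obtain ⟨u, rfl, rfl⟩ := h
  obtain ⟨v, rfl, rfl⟩ := h'
  exact ⟨u * v, rfl, map_mul _ _ _⟩

theorem neg (h : HasValueAt τ f c) : HasValueAt τ (-f) (-c) := by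
  obtain ⟨u, rfl, rfl⟩ := h
  exact ⟨-u, rfl, map_neg _ _⟩

theorem algebraMap_div (p : ℚ[X]) {q : ℚ[X]} (hq : q.eval τ ≠ 0) :
    HasValueAt τ (algebraMap ℚ[X] (RatFunc ℚ) p / algebraMap ℚ[X] (RatFunc ℚ) q)
      (p.eval τ / q.eval τ) := by
  have hmap : ∀ p : ℚ[X], HasValueAt τ (algebraMap ℚ[X] (RatFunc ℚ) p) (p.eval τ) := by
    intro p
    refine ⟨⟨algebraMap ℚ[X] (RatFunc ℚ) p, ?_⟩, rfl, ?_⟩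
    · change Polynomial.eval τ (RatFunc.denom _) ≠ 0
      simp
    · change RatFunc.eval (RingHom.id ℚ) τ (algebraMap ℚ[X] (RatFunc ℚ) p) = _
      rw [RatFunc.eval_algebraMap]
      simp [eval₂_eq_eval_map]
  have hmem : algebraMap ℚ[X] (RatFunc ℚ) p / algebraMap ℚ[X] (RatFunc ℚ) q ∈ regularAt τ := by
    intro h
    have := Polynomial.eval_dvd (x := τ) (RatFunc.denom_div_dvd p q)
    rw [h, zero_dvd_iff] at this
    exact hq this
  have hq0 : algebraMap ℚ[X] (RatFunc ℚ) q ≠ 0 := by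
    refine RatFunc.algebraMap_ne_zero ?_
    rintro rfl
    simp at hq
  have h1 : HasValueAt τ _ _ := ⟨⟨_, hmem⟩, rfl, rfl⟩
  have h2 := h1.mul (hmap q)
  rw [div_mul_cancel₀ _ hq0] at h2
  rw [(hmap p).unique h2, mul_div_cancel_right₀ _ hq]
  exact h1

theorem eq_num_div_denom (h : HasValueAt τ f c) : c = f.num.eval τ / f.denom.eval τ := by
  have := algebraMap_div f.num h.mem
  rw [RatFunc.num_div_denom] at this
  exact h.unique this

theorem inv (h : HasValueAt τ f c) (hc : c ≠ 0) : HasValueAt τ f⁻¹ c⁻¹ := by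
  have h1 := h.eq_num_div_denom
  have h2 : f.num.eval τ ≠ 0 := by
    intro h0
    simp [h0] at h1
    exact hc h1
  have := algebraMap_div f.denom h2
  rwa [← inv_div, RatFunc.num_div_denom, ← inv_div, ← h1] at this

theorem div (h : HasValueAt τ f c) (h' : HasValueAt τ g d) (hd : d ≠ 0) :
    HasValueAt τ (f / g) (c / d) := by
  rw [div_eq_mul_inv, div_eq_mul_inv]
  exact h.mul (h'.inv hd)

theorem inv_of_notMem (hf : f ∉ regularAt τ) : HasValueAt τ f⁻¹ 0 := by
  have h1 : f.denom.eval τ = 0 := not_not.mp hf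
  have h2 : f.num.eval τ ≠ 0 := by
    intro h0
    obtain ⟨a, b, hab⟩ := RatFunc.isCoprime_num_denom f
    have h3 := congrArg (Polynomial.eval τ) hab
    simp [h0, h1] at h3
  have := algebraMap_div f.denom h2
  rwa [← inv_div, RatFunc.num_div_denom, h1, zero_div] at this

theorem ne_zero (h : HasValueAt τ f c) (hc : c ≠ 0) : f ≠ 0 := by
  rintro rfl
  exact hc (h.unique ⟨0, rfl, map_zero _⟩)

theorem pow (h : HasValueAt τ f c) (n : ℕ) : HasValueAt τ (f ^ n) (c ^ n) := by
  obtain ⟨u, rfl, rfl⟩ := h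
  exact ⟨u ^ n, rfl, map_pow _ _ _⟩

/-- A square root of a function with value `1` has value `1` after a change of sign. -/
theorem exists_sign_of_sq (h : HasValueAt τ (f ^ 2) 1) :
    HasValueAt τ f 1 ∨ HasValueAt τ (-f) 1 := by
  have hm : f ∈ regularAt τ := mem_regularAt_of_mul_self (by rw [← sq]; exact h.mem)
  have h1 : HasValueAt τ f (evalAt τ ⟨f, hm⟩) := ⟨⟨f, hm⟩, rfl, rfl⟩
  rcases sq_eq_one_iff.mp ((h1.pow 2).unique h) with h2 | h2
  · exact .inl (h2 ▸ h1)
  · refine .inr ?_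
    have := h1.neg
    rwa [h2, neg_neg] at this

end HasValueAt

theorem sub_div_self_hasValueAt {τ : ℚ} {x e : RatFunc ℚ} (hx : x ∉ regularAt τ)
    (he : e ∈ regularAt τ) : HasValueAt τ ((x - e) / x) 1 := by
  have hx0 : x ≠ 0 := fun h => hx (h ▸ zero_mem _)
  have h1 := (HasValueAt.one τ).sub
    ((show HasValueAt τ e _ from ⟨⟨e, he⟩, rfl, rfl⟩).mul (HasValueAt.inv_of_notMem hx))
  rw [mul_zero, sub_zero] at h1
  convert h1 using 1
  field_simp

/-! ### Square classes and their specialization -/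

theorem sqClass_eq_one_iff {K : Type*} [Field K] {x : K} (hx : x ≠ 0) :
    sqClass x = 1 ↔ ∃ r, r ^ 2 = x := by
  rw [sqClass, dif_pos hx]
  refine (QuotientGroup.eq_one_iff _).trans ⟨?_, ?_⟩
  · rintro ⟨v, hv⟩
    exact ⟨v, by simpa using congrArg Units.val hv⟩
  · rintro ⟨r, rfl⟩
    exact ⟨Units.mk0 r (by rintro rfl; simp at hx), Units.ext rfl⟩

theorem sqClass_sq_mul {K : Type*} [Field K] {x r : K} (hr : r ≠ 0) :
    sqClass (r ^ 2 * x) = sqClass x := by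
  by_cases hx : x = 0
  · simp [hx]
  rw [sqClass, dif_pos (mul_ne_zero (pow_ne_zero 2 hr) hx), sqClass, dif_pos hx]
  have : Units.mk0 _ (mul_ne_zero (pow_ne_zero 2 hr) hx) = Units.mk0 r hr ^ 2 * Units.mk0 x hx :=
    Units.ext rfl
  rw [this, map_mul, mul_eq_right]
  exact (QuotientGroup.eq_one_iff _).mpr ⟨Units.mk0 r hr, rfl⟩

theorem specClass_sqClass_of_hasValueAt_one {τ : ℚ} {f : RatFunc ℚ} (hf : HasValueAt τ f 1)
    (h : sqClass f ∈ specClasses τ) : specClass τ ⟨sqClass f, h⟩ = 1 := by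
  obtain ⟨v, hv, hv1⟩ := hf.inv one_ne_zero
  obtain ⟨u, rfl, hu⟩ := hf
  have hu0 : (u : RatFunc ℚ) ≠ 0 := by
    rintro h0
    have : u = 0 := Subtype.ext h0
    simp [this] at hu
  let w : (regularAt τ)ˣ := ⟨u, v, Subtype.ext (by simp [hv, hu0]), Subtype.ext (by simp [hv, hu0])⟩
  have hw : unitClass τ w = sqClass (u : RatFunc ℚ) := by
    rw [sqClass, dif_pos hu0]
    exact congrArg (sqMk _) (Units.ext rfl)
  have : (⟨sqClass (u : RatFunc ℚ), h⟩ : specClasses τ) = ⟨unitClass τ w, w, rfl⟩ :=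
    Subtype.ext hw.symm
  rw [this, specClass_unitClass, unitValueClass, MonoidHom.comp_apply]
  have : Units.map (evalAt τ : regularAt τ →* ℚ) w = 1 := Units.ext hu
  rw [this, map_one]

/-! ### Halving points with a pole, and injectivity of specialization -/

/-- Halving of a point `(x, y)` with a pole at `τ` all of whose `x - aᵢ` are squares, by a point that
again has a pole at `τ`. -/
theorem exists_half {τ : ℚ} {a : Fin 3 → RatFunc ℚ} (ha : ∀ i, a i ∈ regularAt τ) {x : RatFunc ℚ}
    (hx : x ∉ regularAt τ) (hsq : ∀ i, ∃ r, r ^ 2 = x - a i) :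
    ∃ x' y', x' ∉ regularAt τ ∧ y' ^ 2 = (x' - a 0) * (x' - a 1) * (x' - a 2) ∧
      dupDen (a 1 - a 0) (a 2 - a 0) (x' - a 0) 1 * (x - a 0) =
        dupNum (a 1 - a 0) (a 2 - a 0) (x' - a 0) 1 ∧
      HasValueAt τ ((x' - a 0) / (x - a 0)) 4 := by
  have hx0 : x ≠ 0 := fun h => hx (h ▸ zero_mem _)
  have hval := fun i => sub_div_self_hasValueAt hx (ha i)
  have hne : ∀ i, x - a i ≠ 0 := fun i h => (hval i).ne_zero one_ne_zero (by rw [h, zero_div])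
  obtain ⟨r, hr⟩ := hsq 0
  have hr0 : r ≠ 0 := fun h => hne 0 (by rw [← hr, h]; ring)
  -- The halves have x' - a 0 = (r ± s)(r ± t). Normalizing s/r and t/r to value 1 makes (r + s)(r +
  -- t)/r² take the value 2 · 2 = 4, so the pole survives.
  have hsign : ∀ i, ∃ s, s ^ 2 = x - a i ∧ HasValueAt τ (s / r) 1 := by
    intro i
    obtain ⟨s, hs⟩ := hsq i
    have h1 : HasValueAt τ ((s / r) ^ 2) 1 := by
      have := (hval i).div (hval 0) one_ne_zero
      rwa [div_div_div_cancel_right₀ hx0, ← hs, ← hr, ← div_pow, div_one] at this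
    rcases h1.exists_sign_of_sq with h | h
    · exact ⟨s, hs, h⟩
    · exact ⟨-s, by rw [neg_sq, hs], by rwa [neg_div]⟩
  obtain ⟨s, hs, hsv⟩ := hsign 1
  obtain ⟨t, ht, htv⟩ := hsign 2
  have h10 : a 1 - a 0 = r ^ 2 - s ^ 2 := by rw [hr, hs]; ring
  have h20 : a 2 - a 0 = r ^ 2 - t ^ 2 := by rw [hr, ht]; ring
  have h4 : HasValueAt τ ((r + s) * (r + t) / (x - a 0)) 4 := by
    have := ((HasValueAt.one τ).add hsv).mul ((HasValueAt.one τ).add htv)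
    rw [show (1 + 1 : ℚ) * (1 + 1) = 4 by norm_num] at this
    convert this using 1
    rw [← hr]
    field_simp
  have e1 : a 0 + (r + s) * (r + t) - a 1 = (r + s) * (s + t) := by linear_combination -h10
  have e2 : a 0 + (r + s) * (r + t) - a 2 = (r + t) * (s + t) := by linear_combination -h20
  have e0 : a 0 + (r + s) * (r + t) - a 0 = (r + s) * (r + t) := by ring
  refine ⟨a 0 + (r + s) * (r + t), (r + s) * (r + t) * (s + t), ?_, ?_, ?_, ?_⟩
  -- If x' were regular, its quotient by x - a 0, which has a pole, would have value 0 rather than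
  -- 4.
  · intro hmem
    have h5 := sub_mem hmem (ha 0)
    rw [e0] at h5
    have h6 : x - a 0 ∉ regularAt τ := fun h => hx (by simpa using add_mem h (ha 0))
    have h7 := (show HasValueAt τ _ _ from ⟨⟨_, h5⟩, rfl, rfl⟩).mul (HasValueAt.inv_of_notMem h6)
    rw [← div_eq_mul_inv, mul_zero] at h7
    exact four_ne_zero (h4.unique h7)
  · rw [e0, e1, e2]; ring
  · simp only [dupDen, dupNum]
    rw [e0, h10, h20, ← hr]
    ring
  · rwa [e0]

theorem exists_sq_eq_sub_of_pole {τ : ℚ} {a : Fin 3 → RatFunc ℚ} (ha : ∀ i, a i ∈ regularAt τ)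
    (hdisc : rootDisc a ≠ 0)
    {H' : Subgroup (Fin 3 → SqClass (RatFunc ℚ))} (hδ : ∀ P : Pt a, descentMap a P ∈ H')
    (hspec : H' ≤ specTriples τ) (hinj : Function.Injective (specOn τ H' hspec))
    {x y : RatFunc ℚ} (hx : x ∉ regularAt τ) (hxy : y ^ 2 = (x - a 0) * (x - a 1) * (x - a 2))
    (i : Fin 3) : ∃ r, r ^ 2 = x - a i := by
  have hx0 : x ≠ 0 := fun h => hx (h ▸ zero_mem _)
  have hval := fun i => sub_div_self_hasValueAt hx (ha i)
  have hne : ∀ i, x - a i ≠ 0 := fun i h => (hval i).ne_zero one_ne_zero (by rw [h, zero_div])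
  have hΔ : (curve a).Δ ≠ 0 := by
    rw [curve_Δ]
    exact mul_ne_zero (by norm_num) (pow_ne_zero 2 hdisc)
  have hns := (WeierstrassCurve.Affine.equation_iff_nonsingular_of_Δ_ne_zero hΔ).mp
    ((curve_equation_iff a x y).mpr hxy)
  set P : Pt a := .some x y hns
  have hP : ∀ i, descentMap a P i = sqClass (x - a i) := fun i => by
    simp only [P, descentMap]
    rw [if_neg (sub_ne_zero.mp (hne i))]
  have hy : y ≠ 0 := by
    rintro rfl
    exact mul_ne_zero (mul_ne_zero (hne 0) (hne 1)) (hne 2) (by rw [← hxy]; ring)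
  -- y²/x³ is the product of the three (x - aⱼ)/x, hence has value 1. The function here is (x/y)²(x
  -- - aᵢ), a representative of the class of x - aᵢ that is a unit at τ.
  have hcube : ∀ i, HasValueAt τ (x ^ 3 / y ^ 2 * ((x - a i) / x)) 1 := by
    intro i
    have h1 := (((hval 0).mul (hval 1)).mul (hval 2)).inv (by norm_num)
    have h2 := h1.mul (hval i)
    rw [show ((1 * 1 * 1 : ℚ)⁻¹ * 1) = 1 by norm_num] at h2
    convert h2 using 2
    rw [hxy]
    have := hne 0
    have := hne 1
    have := hne 2
    field_simp
  have hsqc : ∀ i, sqClass (x - a i) = sqClass (x ^ 3 / y ^ 2 * ((x - a i) / x)) := by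
    intro i
    rw [← sqClass_sq_mul (x := x ^ 3 / y ^ 2 * _) (div_ne_zero hy hx0)]
    congr 1
    field_simp
  have hone : specOn τ H' hspec ⟨descentMap a P, hδ P⟩ = 1 := by
    funext j
    have hmem := hspec (hδ P) j (Set.mem_univ j)
    change specClass τ ⟨descentMap a P j, hmem⟩ = 1
    have hj := (hP j).trans (hsqc j)
    have hmem' := hmem
    rw [hj] at hmem'
    rw [← specClass_sqClass_of_hasValueAt_one (hcube j) hmem']
    exact congrArg _ (Subtype.ext hj)
  have htriv := congrArg Subtype.val (hinj (hone.trans (map_one _).symm))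
  have hi : descentMap a P i = 1 := congrFun htriv i
  rw [hP] at hi
  exact (sqClass_eq_one_iff (hne i)).mp hi

theorem rootDisc_genRoots (e : Fin 3 → ℤ[X]) : rootDisc (genRoots e) =
    (algebraMap ℚ[X] (RatFunc ℚ)).comp (mapRingHom (Int.castRingHom ℚ)) (rootDisc e) := by
  simp [rootDisc, genRoots]

theorem intPolynomial_toRatFunc_injective : Function.Injective
    ((algebraMap ℚ[X] (RatFunc ℚ)).comp (mapRingHom (Int.castRingHom ℚ))) :=
  (RatFunc.algebraMap_injective ℚ).comp (Polynomial.map_injective _ Int.cast_injective)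

/-- Under the hypotheses on `h_τ`, no affine point of the curve has a pole at `τ`. -/
theorem mem_regularAt_of_equation {e : Fin 3 → ℤ[X]} {τ : ℚ} (hdisc : rootDisc e ≠ 0)
    {H' : Subgroup (Fin 3 → SqClass (RatFunc ℚ))}
    (hδ : ∀ P : Pt (genRoots e), descentMap (genRoots e) P ∈ H')
    (hspec : H' ≤ specTriples τ) (hinj : Function.Injective (specOn τ H' hspec))
    {x y : RatFunc ℚ}
    (hxy : y ^ 2 = (x - genRoots e 0) * (x - genRoots e 1) * (x - genRoots e 2)) :
    x ∈ regularAt τ := by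
  by_contra hx
  set a := genRoots e with ha_def
  have ha : ∀ i, a i ∈ regularAt τ := genRoots_mem e τ
  have hdisc' : rootDisc a ≠ 0 := by
    rw [ha_def, rootDisc_genRoots]
    exact (map_ne_zero_iff _ intPolynomial_toRatFunc_injective).mpr hdisc
  let S := {x : RatFunc ℚ // x ∉ regularAt τ ∧ ∃ y, y ^ 2 = (x - a 0) * (x - a 1) * (x - a 2)}
  have hstep : ∀ s : S, ∃ s' : S,
      dupDen (a 1 - a 0) (a 2 - a 0) (s'.1 - a 0) 1 * (s.1 - a 0) =
        dupNum (a 1 - a 0) (a 2 - a 0) (s'.1 - a 0) 1 ∧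
      HasValueAt τ ((s'.1 - a 0) / (s.1 - a 0)) 4 := by
    rintro ⟨x, hx, y, hxy⟩
    obtain ⟨x', y', hx', hxy', h1, h2⟩ :=
      exists_half ha hx (exists_sq_eq_sub_of_pole ha hdisc' hδ hspec hinj hx hxy)
    exact ⟨⟨x', hx', y', hxy'⟩, h1, h2⟩
  choose f hf hf4 using hstep
  set X : ℕ → RatFunc ℚ := fun n => (f^[n] ⟨x, hx, y, hxy⟩).1 - a 0 with hX
  have hXs : ∀ n, X (n + 1) = (f (f^[n] ⟨x, hx, y, hxy⟩)).1 - a 0 := fun n => by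
    simp only [hX, Function.iterate_succ_apply']
  have hX0 : ∀ n, X n ≠ 0 := fun n h =>
    (f^[n] ⟨x, hx, y, hxy⟩).2.1 (by rw [sub_eq_zero.mp h]; exact ha 0)
  have hratio : ∀ n k, HasValueAt τ (X (n + k) / X n) (4 ^ k) := by
    intro n k
    induction k with
    | zero => simpa [hX0 n] using HasValueAt.one τ
    | succ k ih =>
      have h4 : HasValueAt τ (X (n + k + 1) / X (n + k)) 4 := by
        rw [hXs]
        exact hf4 _
      have := h4.mul ih
      rw [div_mul_div_cancel₀ (hX0 _)] at this
      rwa [pow_succ', ← add_assoc]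
  -- A repetition would make a ratio equal to 1 have value 4 ^ (k + 1).
  have hXinj : Function.Injective X := by
    refine Function.Injective.of_lt_imp_ne fun n m hnm heq => ?_
    obtain ⟨k, rfl⟩ := Nat.exists_eq_add_of_lt hnm
    have h1 := hratio n (k + 1)
    rw [← add_assoc, ← heq, div_self (hX0 n)] at h1
    have h2 := (HasValueAt.one τ).unique h1
    have h3 : (1 : ℚ) < 4 ^ (k + 1) := one_lt_pow₀ (by norm_num) (Nat.succ_ne_zero k)
    exact h3.ne h2
  refine Set.infinite_range_of_injective hXinj ?_
  refine finite_range_of_dup intPolynomial_toRatFunc_injective exists_intPolynomial_fraction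
    (p := e 1 - e 0) (q := e 2 - e 0) ?_ hX0 fun n => ?_
  · have h : (e 0 - e 1) * (e 0 - e 2) * (e 1 - e 2) ≠ 0 := hdisc
    have h' : dupRes (e 1 - e 0) (e 2 - e 0) =
        16 * (((e 0 - e 1) * (e 0 - e 2)) ^ 2 * (e 1 - e 2) ^ 4) := by
      simp only [dupRes]; ring
    rw [h']
    exact mul_ne_zero (by norm_num) (mul_ne_zero (pow_ne_zero _ (left_ne_zero_of_mul h))
      (pow_ne_zero _ (right_ne_zero_of_mul h)))
  · rw [map_sub, map_sub, hXs]
    exact hf _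

/-! ### Differences of points with equal specialization -/

theorem hasValueAt_genRoots {e : Fin 3 → ℤ[X]} {τ : ℚ} (i : Fin 3) :
    HasValueAt τ (genRoots e i) (specRoots e τ i) :=
  ⟨⟨_, genRoots_mem e τ i⟩, rfl, evalAt_genRoots e τ i⟩

/-- Two distinct affine points with the same regular specialization differ by a point with a pole. -/
theorem exists_pole_of_value_eq {e : Fin 3 → ℤ[X]} {τ : ℚ} (hτ : aeval τ (rootDisc e) ≠ 0)
    {x₁ y₁ x₂ y₂ : RatFunc ℚ} {u v : ℚ}
    (h₁ : (curve (genRoots e)).toAffine.Equation x₁ y₁)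
    (h₂ : (curve (genRoots e)).toAffine.Equation x₂ y₂)
    (hx₁ : HasValueAt τ x₁ u) (hx₂ : HasValueAt τ x₂ u)
    (hy₁ : HasValueAt τ y₁ v) (hy₂ : HasValueAt τ y₂ v) (hne : ¬(x₁ = x₂ ∧ y₁ = y₂)) :
    ∃ x y, x ∉ regularAt τ ∧ (curve (genRoots e)).toAffine.Equation x y := by
  classical
  set W := (curve (genRoots e)).toAffine with hW
  have hnegY : ∀ x y, W.negY x y = -y := fun x y => by
    simp [hW, WeierstrassCurve.Affine.negY, curve]
  have h₂' := (WeierstrassCurve.Affine.equation_neg x₂ y₂).mpr h₂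
  have hne' : ¬(x₁ = x₂ ∧ y₁ = W.negY x₂ (W.negY x₂ y₂)) := by
    rwa [WeierstrassCurve.Affine.negY_negY]
  have hadd := WeierstrassCurve.Affine.equation_add h₁ h₂' hne'
  set l := W.slope x₁ x₂ y₁ (W.negY x₂ y₂) with hl
  set a := genRoots e
  set N := x₁ * x₁ + x₁ * x₂ + x₂ * x₂ - (a 0 + a 1 + a 2) * (x₁ + x₂) +
    (a 0 * a 1 + a 0 * a 2 + a 1 * a 2) with hN
  have e₁ := (curve_equation_iff a x₁ y₁).mp h₁
  have e₂ := (curve_equation_iff a x₂ y₂).mp h₂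
  -- Here l is the slope of the line through (x₁, y₁) and -(x₂, y₂). These two relations cover
  -- secant and tangent alike; N is the divided difference of the cubic.
  have hlx : l * (x₁ - x₂) = y₁ + y₂ ∧ l * (y₁ - y₂) = N := by
    by_cases hx : x₁ = x₂
    · subst hx
      have hy : y₁ ≠ y₂ := fun h => hne ⟨rfl, h⟩
      have hy' : y₁ = -y₂ := by
        have : (y₁ - y₂) * (y₁ + y₂) = 0 := by linear_combination e₁ - e₂
        exact eq_neg_of_add_eq_zero_left ((mul_eq_zero.mp this).resolve_left (sub_ne_zero.mpr hy))
      have hy0 : y₁ - y₂ ≠ 0 := sub_ne_zero.mpr hy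
      have hl' : l = N / (y₁ - y₂) := by
        rw [hl, WeierstrassCurve.Affine.slope_of_Y_ne rfl (by rwa [WeierstrassCurve.Affine.negY_negY]), hnegY]
        have : y₁ - -y₁ = y₁ - y₂ := by rw [hy']; ring
        rw [this, hN]
        simp only [hW, curve]
        congr 1
        ring
      rw [hl', div_mul_cancel₀ _ hy0]
      exact ⟨by rw [hy']; ring, rfl⟩
    · have hx0 := sub_ne_zero.mpr hx
      have hl' : l = (y₁ + y₂) / (x₁ - x₂) := by
        rw [hl, WeierstrassCurve.Affine.slope_of_X_ne hx, hnegY, sub_neg_eq_add]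
      refine ⟨by rw [hl', div_mul_cancel₀ _ hx0], ?_⟩
      rw [hl', div_mul_eq_mul_div, div_eq_iff hx0, hN]
      linear_combination e₁ - e₂
  -- If l were regular, the first relation would give 2v = 0, so u is a root of the specialized
  -- cubic. The second makes the derivative, the value of N, vanish at u. A double root contradicts
  -- Δ(τ) ≠ 0.
  have hl_notMem : l ∉ regularAt τ := by
    intro hmem
    have hlv : HasValueAt τ l _ := ⟨⟨l, hmem⟩, rfl, rfl⟩
    have ha := hasValueAt_genRoots (e := e) (τ := τ)
    have hv : v = 0 := by
      have h1 := hlv.mul (hx₁.sub hx₂)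
      rw [hlx.1] at h1
      have := h1.unique (hy₁.add hy₂)
      linarith
    have hNv := ((((hx₁.mul hx₁).add (hx₁.mul hx₂)).add (hx₂.mul hx₂)).sub
      ((((ha 0).add (ha 1)).add (ha 2)).mul (hx₁.add hx₂))).add
      ((((ha 0).mul (ha 1)).add ((ha 0).mul (ha 2))).add ((ha 1).mul (ha 2)))
    have hN0 := hlv.mul (hy₁.sub hy₂)
    rw [hlx.2] at hN0
    have h0 := hNv.unique hN0
    rw [sub_self, mul_zero] at h0
    have hu := (hy₁.pow 2).unique (e₁ ▸ ((hx₁.sub (ha 0)).mul (hx₁.sub (ha 1))).mul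
      (hx₁.sub (ha 2)))
    rw [hv] at hu
    rw [← rootDisc_specRoots, rootDisc] at hτ
    generalize specRoots e τ 0 = b0 at *
    generalize specRoots e τ 1 = b1 at *
    generalize specRoots e τ 2 = b2 at *
    have hprod : (u - b0) * (u - b1) * (u - b2) = 0 := by rw [← hu]; norm_num
    apply hτ
    rcases mul_eq_zero.mp hprod with h | h
    · rcases mul_eq_zero.mp h with h | h
      · obtain rfl := sub_eq_zero.mp h
        linear_combination (b1 - b2) * h0
      · obtain rfl := sub_eq_zero.mp h
        linear_combination -(b0 - b2) * h0
    · obtain rfl := sub_eq_zero.mp h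
      linear_combination (b0 - b1) * h0
  refine ⟨_, _, fun hmem => hl_notMem ?_, hadd⟩
  -- By the addition formula, l² is the x-coordinate of the difference plus x₁ + x₂ - (a 0 + a 1 + a
  -- 2), so a pole of l forces one of that coordinate.
  refine mem_regularAt_of_mul_self ?_
  have ha := fun i => (hasValueAt_genRoots (e := e) (τ := τ) i).mem
  have h2 := sub_mem (add_mem (add_mem hmem hx₁.mem) hx₂.mem)
    (add_mem (add_mem (ha 0) (ha 1)) (ha 2))
  convert h2 using 1
  simp only [WeierstrassCurve.Affine.addX, hW, curve]
  ring

end EllSpec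

open EllSpec in
theorem corollaryC (e : Fin 3 → Polynomial ℤ) (τ : ℚ)
    (hτ : Polynomial.aeval τ (rootDisc e) ≠ 0)
    (H' : Subgroup (Fin 3 → SqClass (RatFunc ℚ)))
    (hH : H' ≤ descentGroup (RatFunc ℚ))
    (hfg : H'.FG)
    (hδ : ∀ P : Pt (genRoots e), descentMap (genRoots e) P ∈ H')
    (hspec : H' ≤ specTriples τ)
    (hinj : Function.Injective (specOn τ H' hspec)) :
    Function.Injective (specPt e τ hτ) := by
  have hdisc : rootDisc e ≠ 0 := fun h => hτ (by rw [h, map_zero])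
  have hX : ∀ {x y}, (curve (genRoots e)).toAffine.Equation x y → x ∈ regularAt τ := fun h =>
    mem_regularAt_of_equation hdisc hδ hspec hinj ((curve_equation_iff _ _ _).mp h)
  have hreg : ∀ {x y}, (curve (genRoots e)).toAffine.Equation x y →
      x ∈ regularAt τ ∧ y ∈ regularAt τ := by
    intro x y h
    have hx := hX h
    refine ⟨hx, mem_regularAt_of_mul_self ?_⟩
    rw [← sq, (curve_equation_iff _ _ _).mp h]
    exact mul_mem (mul_mem (sub_mem hx (genRoots_mem e τ 0)) (sub_mem hx (genRoots_mem e τ 1)))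
      (sub_mem hx (genRoots_mem e τ 2))
  rintro (_ | ⟨x₁, y₁, h₁⟩) (_ | ⟨x₂, y₂, h₂⟩) heq
  · rfl
  -- With no poles available, an affine point never specializes to the point at infinity.
  · simp [specPt, dif_pos (hreg h₂.1)] at heq
  · simp [specPt, dif_pos (hreg h₁.1)] at heq
  · have r₁ := hreg h₁.1
    have r₂ := hreg h₂.1
    simp only [specPt, dif_pos r₁, dif_pos r₂, WeierstrassCurve.Affine.Point.some.injEq] at heq
    by_contra hne
    obtain ⟨x, y, hx, hxy⟩ := exists_pole_of_value_eq hτ h₁.1 h₂.1 ⟨⟨x₁, r₁.1⟩, rfl, rfl⟩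
      ⟨⟨x₂, r₂.1⟩, rfl, heq.1.symm⟩ ⟨⟨y₁, r₁.2⟩, rfl, rfl⟩ ⟨⟨y₂, r₂.2⟩, rfl, heq.2.symm⟩
      (fun h => hne (by simpa using h))
    exact hx (hX hxy)
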